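/- Let $F$ be a finitely generated non-abelian free group, let $X$ be any finite generating set of $F$, and let $\Gamma=\Gamma(F,X)$ be the Cayley graph, in which distinct $g,h\in F$ are adjacent iff $g^{-1}h\in X\cup X^{-1}$, with its combinatorial metric $d$. An $r$-path is a finite sequence of vertices in which consecutive ones are at distance at most $r$. A set $S$ of vertices $r$-disconnects two sets $A,B$ of vertices if every $r$-path from $A$ to $B$ meets $S$ (possibly at an end point), and it $r$-disconnects a set $P$ if there are $u,v\in P$ such that $S$ $r$-disconnects $\{u\}$ and $\{v\}$. A positive cone of $F$ is a subset $P\subseteq F$ with $PP\subseteq P$ and $F=P\sqcup P^{-1}\sqcup\{1\}$. A negative swamp of width $r$ for a subgroup $H\le F$ (with respect to $P$) is a set $S\subseteq P^{-1}$ that $r$-disconnects $P$ and $r$-disconnects $g_1H$ and $g_2H$ for some $g_1,g_2\in F$. The graph $\Gamma$ is Hucha with respect to a family $\mathcal H$ of subgroups if for every positive cone $P$ of $F$, every $H\in\mathcal H$ and every integer $r>0$ there is a negative swamp of width $r$ for $H$. Then $\Gamma$ is Hucha with respect to the family of all finitely generated subgroups of infinite index in $F$. Moreover, the swamp can be chosen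 to be a ball: for every positive cone $P$ of $F$, every integer $r>0$ and every finitely generated subgroup $H\le F$ of infinite index, there are $c\in F$ and an integer $R\ge 0$ such that the closed ball $\{g\in F: d(g,c)\le R\}$ is contained in $P^{-1}$, $r$-disconnects $P$, and $r$-disconnects $g_1H$ and $g_2H$ for some $g_1,g_2\in F$. -/

import Mathlib

open scoped Pointwise

namespace HuchaProperty

/-- `P` is a positive cone of `G`: it is closed under multiplication and
`G = P ⊔ P⁻¹ ⊔ {1}` (disjoint union). -/
structure IsPositiveCone {G : Type*} [Group G] (P : Set G) : Prop where
  mul_mem : ∀ a ∈ P, ∀ b ∈ P, a * b ∈ P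
  cover : P ∪ P⁻¹ ∪ {1} = Set.univ
  disjoint_inv : Disjoint P P⁻¹
  one_notMem : (1 : G) ∉ P

/-- The closed ball of radius `R` around `v` for the combinatorial metric of the graph `Γ`. -/
def closedBall {V : Type*} (Γ : SimpleGraph V) (v : V) (R : ℕ) : Set V :=
  {u | Γ.edist u v ≤ (R : ℕ∞)}

/-- The vertices `α 0, …, α k` form an `r`-path: consecutive ones are at distance at most `r`.
The values `α i` with `i > k` play no role. -/
def IsRPath {V : Type*} (Γ : SimpleGraph V) (r k : ℕ) (α : ℕ → V) : Prop :=
  ∀ i < k, Γ.edist (α i) (α (i + 1)) ≤ (r : ℕ∞)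

/-- `S` `r`-disconnects `A` and `B`: every `r`-path from `A` to `B` meets `S`. -/
def RDisconnects {V : Type*} (Γ : SimpleGraph V) (r : ℕ) (S A B : Set V) : Prop :=
  ∀ (k : ℕ) (α : ℕ → V), IsRPath Γ r k α → α 0 ∈ A → α k ∈ B → ∃ i ≤ k, α i ∈ S

/-- `S` `r`-disconnects the set `P`: it `r`-disconnects some two points of `P`. -/
def RDisconnectsSet {V : Type*} (Γ : SimpleGraph V) (r : ℕ) (S P : Set V) : Prop :=
  ∃ u ∈ P, ∃ v ∈ P, RDisconnects Γ r S {u} {v}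

/-- `S` is a negative swamp (with respect to the positive cone `P`) of width `r` for the
subgroup `H` in the Cayley graph of `G` with respect to `X`. In `SimpleGraph.mulCayley X`,
distinct `g`, `h` are adjacent iff `g⁻¹ * h` lies in `X` or in `X⁻¹`. -/
structure IsNegativeSwamp {G : Type*} [Group G] (X P : Set G) (H : Subgroup G) (r : ℕ)
    (S : Set G) : Prop where
  subset_inv : S ⊆ P⁻¹
  disconnects_cone : RDisconnectsSet (SimpleGraph.mulCayley X) r S P
  disconnects_cosets : ∃ g₁ g₂ : G,
    RDisconnects (SimpleGraph.mulCayley X) r S (g₁ • (H : Set G)) (g₂ • (H : Set G))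

/-- The Cayley graph of `G` with respect to `X` is Hucha with respect to the family `𝓗`.
Distances are integers, so only integral widths `r` matter. -/
def IsHucha {G : Type*} [Group G] (X : Set G) (𝓗 : Set (Subgroup G)) : Prop :=
  ∀ P : Set G, IsPositiveCone P → ∀ H ∈ 𝓗, ∀ r : ℕ, 0 < r →
    ∃ S : Set G, IsNegativeSwamp X P H r S

end HuchaProperty

namespace HuchaProperty

open SimpleGraph

/-! ### Half-spaces of a group -/

/-! The set `A` of reduced words starting with a fixed letter is a half-space. It has finitely many
exits by jumps of length at most `r`, so a ball of some radius `R` about 1 contains them all, and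
the ball of radius `R` about any `c` separates `c • A` from its complement (`exists_rDisconnects`).
In the left order `x < y ↔ x⁻¹ * y ∈ P`, pick `d` above the ball about 1; its translate by `d⁻¹` is
negative. Both `A` and its complement contain points above `d` (`unbounded`), whose translates are
positive and separated. By `exists_mul_subgroup`, each side also contains a translate of `H`. -/

/-- `A` is a half-space of `G`: right multiplication by any element moves only finitely many
points of `A` out of `A`, and left translations map `A` into its complement and the complement
into `A`. -/
structure IsHalfSpace {G : Type*} [Group G] (A : Set G) : Prop where
  finite_exits : ∀ f : G, {x | x ∈ A ∧ x * f ∉ A}.Finite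
  exists_mul_notMem : ∃ p : G, ∀ x ∈ A, p * x ∉ A
  exists_mul_mem : ∃ q : G, ∀ x ∉ A, q * x ∈ A

section FreeGroup

variable {α : Type*} [DecidableEq α]

/-- An appended letter can cancel only the last letter of a reduced word, so the first letter
survives unless nothing remains. -/
theorem head?_reduce_concat {L : List (α × Bool)} (hL : FreeGroup.IsReduced L) (l : α × Bool) :
    (FreeGroup.reduce (L ++ [l])).head? = L.head? ∨ FreeGroup.reduce (L ++ [l]) = [] ∨ L = [] := by
  induction L with
  | nil => simp
  | cons h t ih =>
    cases t with
    | nil =>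
      rw [List.singleton_append, FreeGroup.reduce.cons, FreeGroup.reduce_singleton]
      by_cases hc : h.1 = l.1 ∧ h.2 = !l.2 <;> simp [hc]
    | cons k t =>
      have hk := FreeGroup.isReduced_cons_cons.mp hL
      rw [List.cons_append, FreeGroup.reduce.cons]
      cases hr : FreeGroup.reduce (k :: t ++ [l]) with
      | nil => simp
      | cons m s =>
        have hm : m = k := by
          have := ih hk.2
          rw [hr] at this
          simpa using this
        subst hm
        have hc : ¬ (h.1 = m.1 ∧ h.2 = !m.2) := fun hc => by
          have := hk.1 hc.1
          simp_all
        simp [hc]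

theorem mem_startsWith_mul_mk {w l : α × Bool} {x : FreeGroup α} (hx : x ∈ FreeGroup.startsWith w)
    (h : x * FreeGroup.mk [l] ≠ 1) : x * FreeGroup.mk [l] ∈ FreeGroup.startsWith w := by
  have hr : (x * FreeGroup.mk [l]).toWord = FreeGroup.reduce (x.toWord ++ [l]) := by
    rw [FreeGroup.toWord_mul, FreeGroup.toWord_mk, FreeGroup.reduce_singleton]
  have hx1 : x.toWord ≠ [] := by
    rw [Ne, FreeGroup.toWord_eq_nil_iff]
    exact FreeGroup.startsWith.ne_one x hx
  simp only [FreeGroup.startsWith, Set.mem_ofPred_eq, ← List.head?_eq_getElem?] at hx ⊢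
  rcases head?_reduce_concat (FreeGroup.isReduced_toWord (x := x)) l with h1 | h1 | h1
  · rw [hr, h1, hx]
  · rw [← hr, FreeGroup.toWord_eq_nil_iff] at h1
    exact absurd h1 h
  · exact absurd h1 hx1

theorem finite_startsWith_exits (w : α × Bool) (f : FreeGroup α) :
    {x | x ∈ FreeGroup.startsWith w ∧ x * f ∉ FreeGroup.startsWith w}.Finite := by
  have letter : ∀ l : α × Bool, {x | x ∈ FreeGroup.startsWith w ∧
      x * FreeGroup.mk [l] ∉ FreeGroup.startsWith w}.Finite := fun l => by
    refine (Set.finite_singleton (FreeGroup.mk [l])⁻¹).subset fun x hx => ?_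
    by_contra hne
    exact hx.2 (mem_startsWith_mul_mk hx.1 fun h => hne (eq_inv_of_mul_eq_one_left h))
  induction f using FreeGroup.induction_on with
  | C1 => simp
  | of a => exact letter (a, true)
  | inv_of a _ => exact letter (a, false)
  | mul f g hf hg =>
    -- An exit by `f * g` is an exit by `f`, or its shift by `f` is an exit by `g`.
    refine (hf.union (hg.image (· * f⁻¹))).subset fun x hx => ?_
    by_cases hxf : x * f ∈ FreeGroup.startsWith w
    · exact Or.inr ⟨x * f, ⟨hxf, by simpa [mul_assoc] using hx.2⟩, by simp⟩
    · exact Or.inl ⟨hx.1, hxf⟩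

theorem isHalfSpace_startsWith {a b : α} (hab : a ≠ b) :
    IsHalfSpace (FreeGroup.startsWith (a, true)) where
  finite_exits := finite_startsWith_exits _
  exists_mul_notMem := by
    refine ⟨FreeGroup.mk [(b, true)], fun x hx => ?_⟩
    have hx' : x ∉ FreeGroup.startsWith (b, false) :=
      (FreeGroup.startsWith.disjoint_iff_ne.mpr (by simp)).notMem_of_mem_left hx
    exact (FreeGroup.startsWith.disjoint_iff_ne.mpr (by simpa using hab.symm)).notMem_of_mem_left
      (FreeGroup.startsWith_mk_mul (w := (b, true)) x hx')
  exists_mul_mem := by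
    -- The element is `a * b * a⁻¹`: when `x` does not start with `a`, none of the three successive
    -- left multiplications cancels.
    refine ⟨FreeGroup.mk [(a, true)] * (FreeGroup.mk [(b, true)] * FreeGroup.mk [(a, false)]),
      fun x hx => ?_⟩
    have h1 := FreeGroup.startsWith_mk_mul (w := (a, false)) x hx
    have h2 := FreeGroup.startsWith_mk_mul (w := (b, true)) _
      ((FreeGroup.startsWith.disjoint_iff_ne (w' := (b, false)) |>.mpr
        (by simpa using hab)).notMem_of_mem_left h1)
    have h3 := FreeGroup.startsWith_mk_mul (w := (a, true)) _
      ((FreeGroup.startsWith.disjoint_iff_ne (w' := (a, false)) |>.mpr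
        (by simp)).notMem_of_mem_left h2)
    simpa only [mul_assoc] using h3

end FreeGroup

theorem freeGroup_mul_comm_of_subsingleton {α : Type*} [Subsingleton α] (x y : FreeGroup α) :
    x * y = y * x := by
  change Commute x y
  induction x using FreeGroup.induction_on with
  | C1 => exact Commute.one_left y
  | inv_of a h => exact h.inv_left
  | mul f g hf hg => exact hf.mul_left hg
  | of a =>
    induction y using FreeGroup.induction_on with
    | C1 => exact Commute.one_right _
    | inv_of b h => exact h.inv_right
    | mul f g hf hg => exact hf.mul_right hg
    | of b => rw [Subsingleton.elim a b]

theorem IsHalfSpace.preimage {G K : Type*} [Group G] [Group K] {A : Set K} (hA : IsHalfSpace A)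
    (e : G ≃* K) : IsHalfSpace (e ⁻¹' A) where
  finite_exits f := by
    simpa [Set.preimage] using (hA.finite_exits (e f)).preimage e.injective.injOn
  exists_mul_notMem := by
    obtain ⟨p, hp⟩ := hA.exists_mul_notMem
    exact ⟨e.symm p, fun x hx => by simpa using hp _ hx⟩
  exists_mul_mem := by
    obtain ⟨q, hq⟩ := hA.exists_mul_mem
    exact ⟨e.symm q, fun x hx => by simpa using hq _ hx⟩

/-- A non-abelian free group has a half-space. -/
theorem exists_isHalfSpace {F : Type*} [Group F] [IsFreeGroup F]
    (hF : ∃ a b : F, a * b ≠ b * a) : ∃ A : Set F, IsHalfSpace A := by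
  classical
  let e := IsFreeGroup.toFreeGroup F
  have hgen : Nontrivial (IsFreeGroup.Generators F) := by
    by_contra hn
    rw [not_nontrivial_iff_subsingleton] at hn
    obtain ⟨a, b, hab⟩ := hF
    apply hab
    apply e.injective
    rw [map_mul, map_mul, freeGroup_mul_comm_of_subsingleton]
  obtain ⟨a, b, hab⟩ := hgen
  exact ⟨_, (isHalfSpace_startsWith hab).preimage e⟩

/-! ### Balls in Cayley graphs -/

section Cayley

variable {G : Type*} [Group G] {X : Set G}

theorem edist_mulCayley_mul_left_le (g u v : G) :
    (mulCayley X).edist (g * u) (g * v) ≤ (mulCayley X).edist u v := by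
  by_cases h : (mulCayley X).Reachable u v
  · obtain ⟨w, hw⟩ := h.exists_walk_length_eq_edist
    let φ : mulCayley X →g mulCayley X := ⟨(g * ·), fun h => mulCayley_adj_mul_iff_right.mpr h⟩
    rw [← hw, ← Walk.length_map φ w]
    exact edist_le _
  · rw [edist_eq_top_of_not_reachable h]
    exact le_top

theorem inv_mul_mem_closedBall {c x : G} {R : ℕ} (h : x ∈ closedBall (mulCayley X) c R) :
    c⁻¹ * x ∈ closedBall (mulCayley X) 1 R := by
  have := edist_mulCayley_mul_left_le (X := X) c⁻¹ x c
  rw [inv_mul_cancel] at this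
  exact this.trans h

theorem mul_mem_closedBall (c : G) {x : G} {R : ℕ} (h : x ∈ closedBall (mulCayley X) 1 R) :
    c * x ∈ closedBall (mulCayley X) c R := by
  have := edist_mulCayley_mul_left_le (X := X) c x 1
  rw [mul_one] at this
  exact this.trans h

theorem finite_closedBall_mulCayley (hX : X.Finite) (R : ℕ) :
    (closedBall (mulCayley X) 1 R).Finite := by
  have key : ∀ n : ℕ, {x : G | ∃ w : (mulCayley X).Walk x 1, w.length = n}.Finite := by
    intro n
    induction n with
    | zero =>
      refine (Set.finite_singleton (1 : G)).subset ?_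
      rintro x ⟨w, hw⟩
      exact Walk.eq_of_length_eq_zero hw
    | succ n ih =>
      refine (ih.mul (hX.union hX.inv)).subset ?_
      rintro x ⟨w, hw⟩
      cases w with
      | nil => simp at hw
      | cons h w =>
        rename_i y
        refine Set.mem_mul.mpr ⟨y, ⟨w, by simpa using hw⟩, y⁻¹ * x, ?_, by simp⟩
        rcases ((mulCayley_adj X x y).mp h).2 with h | h
        · exact Or.inr (by simpa using h)
        · exact Or.inl h
  refine ((Set.finite_Iic R).biUnion fun n _ => key n).subset fun x hx => ?_
  have hx' : (mulCayley X).edist x 1 ≤ R := hx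
  have hr : (mulCayley X).Reachable x 1 := by
    apply reachable_of_edist_ne_top
    exact ne_top_of_le_ne_top (ENat.natCast_ne_top R) hx'
  obtain ⟨w, hw⟩ := hr.exists_walk_length_eq_edist
  rw [← hw] at hx'
  exact Set.mem_biUnion (Set.mem_Iic.mpr (by exact_mod_cast hx')) ⟨w, rfl⟩

theorem reachable_one_mulCayley (hX : Subgroup.closure X = ⊤) (x : G) :
    (mulCayley X).Reachable x 1 := by
  have hx : x ∈ Subgroup.closure X := hX ▸ Subgroup.mem_top x
  have adj : ∀ y s : G, s ∈ X → (mulCayley X).Reachable (y * s) y := fun y s hs => by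
    by_cases h : y * s = y
    · rw [h]
    · exact Adj.reachable ((mulCayley_adj X _ _).mpr ⟨h, Or.inr (by simpa using hs)⟩)
  induction hx using Subgroup.closure_induction_right with
  | one => exact Reachable.refl _
  | mul_right y _ s hs ih => exact (adj y s hs).trans ih
  | mul_inv_cancel y _ s hs ih =>
    have := adj (y * s⁻¹) s hs
    rw [inv_mul_cancel_right] at this
    exact this.symm.trans ih

theorem exists_subset_closedBall (hX : Subgroup.closure X = ⊤) {E : Set G} (hE : E.Finite) :
    ∃ R : ℕ, E ⊆ closedBall (mulCayley X) 1 R := by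
  induction E, hE using Set.Finite.induction_on with
  | empty => exact ⟨0, Set.empty_subset _⟩
  | @insert a s _ _ ih =>
    obtain ⟨R, hR⟩ := ih
    obtain ⟨w⟩ := reachable_one_mulCayley hX a
    refine ⟨max R w.length, Set.insert_subset ?_ fun x hx => ?_⟩
    · exact (edist_le w).trans (by exact_mod_cast le_max_right _ _)
    · exact (show (mulCayley X).edist x 1 ≤ R from hR hx).trans
        (by exact_mod_cast le_max_left _ _)

/-- Some ball around `c`, of radius independent of `c`, separates the translate by `c` of a
half-space from its complement. -/
theorem IsHalfSpace.exists_rDisconnects {A : Set G} (hA : IsHalfSpace A) (hXfin : X.Finite)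
    (hX : Subgroup.closure X = ⊤) (r : ℕ) :
    ∃ R : ℕ, ∀ (c : G) (U V : Set G), (∀ u ∈ U, c⁻¹ * u ∈ A) → (∀ v ∈ V, c⁻¹ * v ∉ A) →
      RDisconnects (mulCayley X) r (closedBall (mulCayley X) c R) U V := by
  obtain ⟨R, hR⟩ := exists_subset_closedBall hX
    ((finite_closedBall_mulCayley hXfin r).biUnion fun f _ => hA.finite_exits f)
  refine ⟨R, fun c U V hU hV k α hα h0 hk => ?_⟩
  by_contra! hcon
  -- The first jump out of the translated half-space would start inside the ball.
  have stay : ∀ i ≤ k, c⁻¹ * α i ∈ A := by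
    intro i
    induction i with
    | zero => exact fun _ => hU _ h0
    | succ i ih =>
      intro hi
      by_contra hout
      have hf : (α i)⁻¹ * α (i + 1) ∈ closedBall (mulCayley X) 1 r := by
        refine inv_mul_mem_closedBall ?_
        have := hα i (by omega)
        rwa [edist_comm] at this
      have hmem : c⁻¹ * α i ∈ closedBall (mulCayley X) 1 R :=
        hR (Set.mem_biUnion hf ⟨ih (by omega), by simpa [mul_assoc] using hout⟩)
      have := mul_mem_closedBall c hmem
      rw [mul_inv_cancel_left] at this
      exact hcon i (by omega) this
  exact hV _ hk (stay k le_rfl)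

end Cayley

/-! ### Subgroups of infinite index -/

/-- If every translate of `H` met both sides, each would contain an exit along a generator of `H` or
its inverse. These exits are finite in number, so `H` would have finite index. -/
theorem IsHalfSpace.exists_mul_subgroup {G : Type*} [Group G] {A : Set G} (hA : IsHalfSpace A)
    {H : Subgroup G} (hfg : H.FG) (hind : ¬ H.FiniteIndex) :
    ∃ g₁ g₂ : G, (∀ h ∈ H, g₁ * h ∈ A) ∧ ∀ h ∈ H, g₂ * h ∉ A := by
  obtain ⟨p, hp⟩ := hA.exists_mul_notMem
  obtain ⟨q, hq⟩ := hA.exists_mul_mem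
  suffices h : ∃ g : G, (∀ h ∈ H, g * h ∈ A) ∨ ∀ h ∈ H, g * h ∉ A by
    obtain ⟨g, h | h⟩ := h
    · exact ⟨g, p * g, h, fun x hx => by simpa [mul_assoc] using hp _ (h x hx)⟩
    · exact ⟨q * g, g, fun x hx => by simpa [mul_assoc] using hq _ (h x hx), h⟩
  by_contra! hcross
  obtain ⟨S, hS⟩ := hfg
  let E : Set G := ⋃ s ∈ (S : Set G), ({x | x ∈ A ∧ x * s ∉ A} ∪ {x | x ∈ A ∧ x * s⁻¹ ∉ A})
  have hE : E.Finite := S.finite_toSet.biUnion fun s _ =>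
    (hA.finite_exits s).union (hA.finite_exits s⁻¹)
  have hHE : ∀ g : G, ∃ h ∈ H, g * h ∈ E := by
    intro g
    by_contra! hno
    have hinv : ∀ y ∈ H, ∀ h ∈ H, g * y ∈ A → g * (y * h) ∈ A := by
      intro y hy h hh
      rw [← hS] at hh
      induction hh using Subgroup.closure_induction_right with
      | one => simp
      | mul_right z hz s hs ih =>
        intro hyA
        by_contra hout
        exact hno (y * z) (H.mul_mem hy (hS ▸ hz)) (Set.mem_biUnion hs
          (Or.inl ⟨ih hyA, by simpa [mul_assoc] using hout⟩))
      | mul_inv_cancel z hz s hs ih =>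
        intro hyA
        by_contra hout
        exact hno (y * z) (H.mul_mem hy (hS ▸ hz)) (Set.mem_biUnion hs
          (Or.inr ⟨ih hyA, by simpa [mul_assoc] using hout⟩))
    obtain ⟨⟨h₁, hh₁, ho⟩, ⟨h₂, hh₂, hi⟩⟩ := hcross g
    exact ho (by simpa using hinv h₂ hh₂ (h₂⁻¹ * h₁) (H.mul_mem (H.inv_mem hh₂) hh₁) hi)
  apply hind
  have hfin : (Set.univ : Set (G ⧸ H)).Finite := by
    refine (hE.image (QuotientGroup.mk : G → G ⧸ H)).subset fun x _ => ?_
    induction x using QuotientGroup.induction_on with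
    | H g =>
      obtain ⟨h, hh, hgh⟩ := hHE g
      exact ⟨g * h, hgh, QuotientGroup.mk_mul_of_mem g hh⟩
  have : Finite (G ⧸ H) := Set.finite_univ_iff.mp hfin
  exact Subgroup.finiteIndex_of_finite_quotient

/-! ### Positive cones -/

section Cone

variable {G : Type*} [Group G] {P : Set G}

theorem IsPositiveCone.nonempty [Nontrivial G] (hP : IsPositiveCone P) : P.Nonempty := by
  obtain ⟨g, hg⟩ := exists_ne (1 : G)
  have : g ∈ P ∪ P⁻¹ ∪ {1} := hP.cover ▸ Set.mem_univ g
  rcases this with (h | h) | h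
  · exact ⟨g, h⟩
  · exact ⟨g⁻¹, h⟩
  · exact absurd h hg

/-- In the left order with positive cone `P`, finite sets are strictly bounded above. -/
theorem IsPositiveCone.exists_upper_bound [Nontrivial G] (hP : IsPositiveCone P) {B : Set G}
    (hB : B.Finite) : ∃ d : G, ∀ b ∈ B, b⁻¹ * d ∈ P := by
  obtain ⟨p, hp⟩ := hP.nonempty
  induction B, hB using Set.Finite.induction_on with
  | empty => exact ⟨1, by simp⟩
  | @insert a s _ _ ih =>
    obtain ⟨d, hd⟩ := ih
    have : a⁻¹ * d ∈ P ∪ P⁻¹ ∪ {1} := hP.cover ▸ Set.mem_univ _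
    rcases this with (h | h) | h
    · exact ⟨d, by simpa using ⟨h, hd⟩⟩
    -- Here `d < a`; the positive factor `p` makes the bound strict at `a` itself.
    · refine ⟨a * p, ?_⟩
      simp only [Set.mem_insert_iff, forall_eq_or_imp, inv_mul_cancel_left]
      refine ⟨hp, fun b hb => ?_⟩
      have h' : d⁻¹ * a ∈ P := by simpa using h
      simpa [mul_assoc] using hP.mul_mem _ (hd b hb) _ (hP.mul_mem _ h' _ hp)
    · refine ⟨d * p, ?_⟩
      have h' : a⁻¹ * d = 1 := h
      simp only [Set.mem_insert_iff, forall_eq_or_imp]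
      refine ⟨by rwa [← mul_assoc, h', one_mul], fun b hb => ?_⟩
      rw [← mul_assoc]
      exact hP.mul_mem _ (hd b hb) _ hp

/-- In the left order with positive cone `P`, neither a half-space nor its complement is bounded
above. -/
theorem IsHalfSpace.unbounded [Nontrivial G] {A : Set G} (hA : IsHalfSpace A)
    (hP : IsPositiveCone P) :
    (∀ d : G, ∃ g ∈ A, d⁻¹ * g ∈ P) ∧ ∀ d : G, ∃ g ∉ A, d⁻¹ * g ∈ P := by
  obtain ⟨p, hp⟩ := hA.exists_mul_notMem
  obtain ⟨q, hq⟩ := hA.exists_mul_mem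
  have out : (∀ d : G, ∃ g ∈ A, d⁻¹ * g ∈ P) → ∀ d : G, ∃ g ∉ A, d⁻¹ * g ∈ P := fun h d => by
    obtain ⟨g, hg, hd⟩ := h (p⁻¹ * d)
    exact ⟨p * g, hp g hg, by simpa [mul_assoc] using hd⟩
  have into : (∀ d : G, ∃ g ∉ A, d⁻¹ * g ∈ P) → ∀ d : G, ∃ g ∈ A, d⁻¹ * g ∈ P := fun h d => by
    obtain ⟨g, hg, hd⟩ := h (q⁻¹ * d)
    exact ⟨q * g, hq g hg, by simpa [mul_assoc] using hd⟩
  by_cases h : ∀ d : G, ∃ g ∈ A, d⁻¹ * g ∈ P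
  · exact ⟨h, out h⟩
  · suffices h' : ∀ d : G, ∃ g ∉ A, d⁻¹ * g ∈ P from ⟨into h', h'⟩
    push Not at h
    -- No point of `A` is above `m`, so anything above both `m` and `d` lies outside `A`.
    obtain ⟨m, hm⟩ := h
    intro d
    obtain ⟨g, hg⟩ := hP.exists_upper_bound (Set.toFinite {m, d})
    exact ⟨g, fun hgA => hm g hgA (hg m (by simp)), hg d (by simp)⟩

end Cone

/-- In a group with a half-space, balls in Cayley graphs can be chosen as negative swamps. -/
theorem IsHalfSpace.exists_isNegativeSwamp_closedBall {G : Type*} [Group G] [Nontrivial G]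
    {A : Set G} (hA : IsHalfSpace A) {X : Set G} (hXfin : X.Finite)
    (hXgen : Subgroup.closure X = ⊤) {P : Set G} (hP : IsPositiveCone P) (r : ℕ)
    {H : Subgroup G} (hfg : H.FG) (hind : ¬ H.FiniteIndex) :
    ∃ (c : G) (R : ℕ), IsNegativeSwamp X P H r (closedBall (mulCayley X) c R) := by
  obtain ⟨R, hR⟩ := hA.exists_rDisconnects hXfin hXgen r
  obtain ⟨d, hd⟩ := hP.exists_upper_bound (finite_closedBall_mulCayley hXfin R)
  obtain ⟨hin, hout⟩ := hA.unbounded hP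
  obtain ⟨u, huA, hu⟩ := hin d
  obtain ⟨v, hvA, hv⟩ := hout d
  obtain ⟨g₁, g₂, h₁, h₂⟩ := hA.exists_mul_subgroup hfg hind
  -- For `x` in the ball about `d⁻¹`, `d * x` is in the ball about 1, hence below `d`, which says
  -- `x⁻¹ ∈ P`.
  refine ⟨d⁻¹, R, ?_, ?_, d⁻¹ * g₁, d⁻¹ * g₂, ?_⟩
  · intro x hx
    have := hd _ (inv_mul_mem_closedBall hx)
    simpa using this
  · exact ⟨_, hu, _, hv, hR _ _ _ (by simpa using huA) (by simpa using hvA)⟩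
  · refine hR _ _ _ ?_ ?_
    · rintro _ ⟨h, hh, rfl⟩
      simpa [mul_assoc] using h₁ h hh
    · rintro _ ⟨h, hh, rfl⟩
      simpa [mul_assoc] using h₂ h hh

end HuchaProperty

theorem mainTheorem12 {F : Type*} [Group F] [IsFreeGroup F] (hfg : Group.FG F)
    (hF : ∃ a b : F, a * b ≠ b * a)
    (X : Set F) (hXfin : X.Finite) (hXgen : Subgroup.closure X = ⊤) :
    HuchaProperty.IsHucha X {H : Subgroup F | H.FG ∧ ¬ H.FiniteIndex} ∧
    ∀ P : Set F, HuchaProperty.IsPositiveCone P → ∀ r : ℕ, 0 < r →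
      ∀ H : Subgroup F, H.FG → ¬ H.FiniteIndex →
        ∃ (c : F) (R : ℕ), HuchaProperty.IsNegativeSwamp X P H r
          (HuchaProperty.closedBall (SimpleGraph.mulCayley X) c R) := by
  obtain ⟨A, hA⟩ := HuchaProperty.exists_isHalfSpace hF
  have : Nontrivial F := by
    obtain ⟨a, b, hab⟩ := hF
    exact ⟨a * b, b * a, hab⟩
  refine ⟨fun P hP H hH r _ => ?_, fun P hP r _ H hfg hind =>
    hA.exists_isNegativeSwamp_closedBall hXfin hXgen hP r hfg hind⟩
  obtain ⟨c, R, h⟩ := hA.exists_isNegativeSwamp_closedBall hXfin hXgen hP r hH.1 hH.2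
  exact ⟨_, h⟩
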